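/- A training set is a finite set $P$ of points in Euclidean space in which every point $p$ has a class $l(p)$. A nearest enemy of $p\in P$ is a closest point to $p$ among the points of $P$ whose class differs from $l(p)$, and $\kappa=\kappa(P)$ denotes the number of distinct points of $P$ that are a nearest enemy of some point of $P$. The algorithm FCNN computes a subset $R\subseteq P$ as follows. Initially $R=\emptyset$ and $S$ contains, for every class, one point of this class closest to the mean of the class (its centroid). While $S\ne\emptyset$: replace $R$ by $R\cup S$; assign to every $q\in P$ a nearest neighbor $\mathrm{nn}(q,R)$ in $R$; then let the new $S$ contain, for each $p\in R$ for which $\{q\in P : \mathrm{nn}(q,R)=p,\ l(q)\neq l(p)\}$ is nonempty, one point of this set closest to $p$. When $S=\emptyset$, return $R$. Theorem. There are an integer $K\ge 2$ and a constant $c>0$ such that for every dimension $d\ge 3$ and every $0<\xi<1$ there is a training set $P\subset\mathbb{R}^d$ with exactly $K$ (nonempty) classes such that FCNN terminates with some output on $P$ and, however ties are broken (among centroids, nearest neighbors and closest representatives), every output $R$ of FCNN on $P$ satisfies $|R|\ge c\,\kappa/\xi$. That is, FCNN selects $\Omega(\kappa/\xi)$ points, with a constant number of classes. (If a point has several nearest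 enemies, all of them are counted in $\kappa$.) -/

import Mathlib

/-!
A training set is a finite set `P` of points of a Euclidean space together with a labelling `l`
of the points by classes; only the labels of the points of `P` matter.
No general position is assumed, so all notions below that select a closest point are relations:
every closest point is admissible.
-/

namespace FCNN

/-- `p` is a nearest neighbour of `q` in the set `R`. -/
def IsNearest {X : Type*} [MetricSpace X] (R : Set X) (q p : X) : Prop :=
  p ∈ R ∧ ∀ r ∈ R, dist q p ≤ dist q r

/-- `e` is a nearest enemy of `p`: a closest point of `P` to `p` among those of another class. -/
def IsNearestEnemy {X L : Type*} [MetricSpace X] (P : Finset X) (l : X → L) (p e : X) : Prop :=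
  IsNearest {q | q ∈ P ∧ l q ≠ l p} p e

/-- The number `κ` of distinct nearest-enemy points of the training set. In case of ties, all
nearest enemies of a point are counted. -/
noncomputable def kappa {X L : Type*} [MetricSpace X] (P : Finset X) (l : X → L) : ℕ :=
  {e : X | ∃ p ∈ P, IsNearestEnemy P l p e}.ncard

/-- The geometrical centre (mean) of the points of class `k`. -/
noncomputable def classMean {X L : Type*} [NormedAddCommGroup X] [NormedSpace ℝ X] [DecidableEq L]
    (P : Finset X) (l : X → L) (k : L) : X :=
  ((P.filter (fun q => l q = k)).card : ℝ)⁻¹ • ∑ q ∈ P.filter (fun q => l q = k), q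

/-- `p` is a centroid of class `k`: a point of this class closest to its geometrical centre. -/
def IsClassCentroid {X L : Type*} [NormedAddCommGroup X] [NormedSpace ℝ X] [DecidableEq L]
    (P : Finset X) (l : X → L) (k : L) (p : X) : Prop :=
  IsNearest {q | q ∈ P ∧ l q = k} (classMean P l k) p

/-- `S` is an admissible value of `centroids(P)`: one centroid for each class that occurs. -/
def IsCentroidSet {X L : Type*} [NormedAddCommGroup X] [NormedSpace ℝ X] [DecidableEq L]
    (P : Finset X) (l : X → L) (S : Set X) : Prop :=
  ∃ cen : L → X, (∀ p ∈ P, IsClassCentroid P l (l p) (cen (l p))) ∧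
    S = {s | ∃ p ∈ P, cen (l p) = s}

/-- `voren(p, R, P)`, the points of `P` that have nearest neighbour `p` in `R` and belong to
another class than `p`; `nn` assigns to each point its nearest neighbour in `R`. -/
def voren {X L : Type*} (P : Finset X) (l : X → L) (nn : X → X) (p : X) : Set X :=
  {q | q ∈ P ∧ nn q = p ∧ l q ≠ l p}

/-- `S` is an admissible outcome of the inner loop of the algorithm for the current subset `R`:
after some choice `nn` of nearest neighbours in `R`, it consists of one representative for each
`p ∈ R` with nonempty `voren(p, R, P)`, namely a point of `voren(p, R, P)` closest to `p`. -/
def IsRepSet {X L : Type*} [MetricSpace X] (P : Finset X) (l : X → L) (R S : Set X) : Prop :=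
  ∃ nn : X → X, (∀ q ∈ P, IsNearest R q (nn q)) ∧
    ∃ rep : X → X,
      (∀ p ∈ R, (voren P l nn p).Nonempty → IsNearest (voren P l nn p) p (rep p)) ∧
      S = {s | ∃ p ∈ R, (voren P l nn p).Nonempty ∧ rep p = s}

/-- `State P l R S`: some execution of FCNN on the training set `(P, l)` arrives at the test of its
while-loop with current subset `R` and set `S` of points to be added. -/
inductive State {X L : Type*} [NormedAddCommGroup X] [NormedSpace ℝ X] [DecidableEq L]
    (P : Finset X) (l : X → L) : Set X → Set X → Prop
  | init (S : Set X) : IsCentroidSet P l S → State P l ∅ S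
  | step (R S S' : Set X) : State P l R S → S.Nonempty → IsRepSet P l (R ∪ S) S' →
      State P l (R ∪ S) S'

/-- `R` is the subset returned by some execution of FCNN: the loop ends once `S` is empty. -/
def IsOutput {X L : Type*} [NormedAddCommGroup X] [NormedSpace ℝ X] [DecidableEq L]
    (P : Finset X) (l : X → L) (R : Set X) : Prop :=
  State P l R ∅

end FCNN

namespace FCNN

/-! Two classes suffice: there are sets with κ ≤ 2 on which FCNN selects arbitrarily many points.
Each colour σ has `n` rungs `u σ i` shrinking very fast towards the origin, an inner point `z σ`
much nearer to the origin than any rung, and a remote outer point `x σ`. The outer point pulls the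
class mean so that the first rung is the centroid, while every point has the inner point of the
other colour as its only nearest enemy.

Once all rungs up to level k are selected, `u (!σ) (k + 1)` is nearest to `u σ k`, hence
misclassified, and among the misclassified points owned by `u σ k` it is the closest one. Inner and
outer points are always classified correctly. So each round adds one rung per colour
(`IsLadder.repSet_eq`, `IsLadder.state`), and the output has at least 2n points; any n > 1/ξ will
do.

The difficulty is that, seen from `u σ k`, the next rung of the other colour must be closer than all
smaller ones, although these are nearly at the origin, and yet farther than `z (!σ)`. The squared
distance between opposite rungs is the sum of their squared norms plus a multiple of `repulsion`,
which is negative only at consecutive levels (`repulsion_succ`, `le_repulsion`). The scales then put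
the next rung outside the sphere about `u σ k` through the origin by a margin proportional to η
(`Fits.dist_rung_next_sq`). Smaller rungs exceed this margin (`Fits.next_closest`), and the inner
point, with ε far below η, stays under it (`Fits.inner_lt_rung`). -/

/-! ### General facts: nearest points, termination of FCNN, distances to a mean. -/

theorem exists_isNearest {X : Type*} [MetricSpace X] {R : Set X} (hf : R.Finite)
    (hne : R.Nonempty) (q : X) : ∃ p, IsNearest R q p :=
  Set.exists_min_image R (dist q) hf hne

theorem IsNearest.eq_of_forall_lt {X : Type*} [MetricSpace X] {R : Set X} {q p r : X}
    (h : IsNearest R q p) (hr : r ∈ R) (hlt : ∀ t ∈ R, t ≠ r → dist q r < dist q t) : p = r := by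
  by_contra hne
  exact absurd (h.2 r hr) (not_le.2 (hlt p h.1 hne))

theorem IsNearest.eq_self {X : Type*} [MetricSpace X] {R : Set X} {q p : X}
    (h : IsNearest R q p) (hq : q ∈ R) : p = q :=
  h.eq_of_forall_lt hq fun t _ ht => by simpa using dist_pos.2 ht.symm

theorem exists_isRepSet {X L : Type*} [MetricSpace X] (P : Finset X) (l : X → L) {R : Set X}
    (hf : R.Finite) (hne : R.Nonempty) : ∃ S, IsRepSet P l R S := by
  classical
  choose nn hnn using exists_isNearest hf hne
  have hrep : ∀ p, ∃ r, (voren P l nn p).Nonempty → IsNearest (voren P l nn p) p r := by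
    intro p
    by_cases h : (voren P l nn p).Nonempty
    · obtain ⟨r, hr⟩ := exists_isNearest (P.finite_toSet.subset fun q hq => hq.1) h p
      exact ⟨r, fun _ => hr⟩
    · exact ⟨p, fun h' => absurd h' h⟩
  choose rep hr using hrep
  exact ⟨_, nn, fun q _ => hnn q, rep, fun p _ => hr p, rfl⟩

theorem IsRepSet.subset {X L : Type*} [MetricSpace X] {P : Finset X} {l : X → L} {R S : Set X}
    (h : IsRepSet P l R S) : S ⊆ P := by
  obtain ⟨nn, -, rep, hrep, rfl⟩ := h
  rintro s ⟨p, hp, hne, rfl⟩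
  exact (hrep p hp hne).1.1

/-- A selected point is its own nearest neighbour, so it is never misclassified. This makes `R` grow
strictly in every round and gives termination. -/
theorem IsRepSet.disjoint {X L : Type*} [MetricSpace X] {P : Finset X} {l : X → L} {R S : Set X}
    (h : IsRepSet P l R S) : Disjoint R S := by
  obtain ⟨nn, hnn, rep, hrep, rfl⟩ := h
  rw [Set.disjoint_right]
  rintro s ⟨p, hp, hne, rfl⟩ hR
  obtain ⟨hP, hn, hl⟩ := (hrep p hp hne).1
  have h1 := (hnn _ hP).eq_self hR
  rw [h1] at hn
  exact hl (by rw [hn])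

theorem IsCentroidSet.subset {X L : Type*} [NormedAddCommGroup X] [NormedSpace ℝ X]
    [DecidableEq L] {P : Finset X} {l : X → L} {S : Set X} (h : IsCentroidSet P l S) : S ⊆ P := by
  obtain ⟨cen, hcen, rfl⟩ := h
  rintro s ⟨p, hp, rfl⟩
  exact (hcen p hp).1.1

theorem exists_isCentroidSet {X L : Type*} [NormedAddCommGroup X] [NormedSpace ℝ X]
    [DecidableEq L] (P : Finset X) (l : X → L) : ∃ S, IsCentroidSet P l S := by
  classical
  have hcen : ∀ k, ∃ c, ∀ p ∈ P, l p = k → IsClassCentroid P l k c := by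
    intro k
    by_cases h : {q | q ∈ P ∧ l q = k}.Nonempty
    · obtain ⟨c, hc⟩ := exists_isNearest (P.finite_toSet.subset fun q hq => hq.1) h
        (classMean P l k)
      exact ⟨c, fun _ _ _ => hc⟩
    · exact ⟨0, fun p hp hl => absurd ⟨p, hp, hl⟩ h⟩
  choose cen hc using hcen
  exact ⟨_, cen, fun p hp => hc _ p hp rfl, rfl⟩

theorem State.subset {X L : Type*} [NormedAddCommGroup X] [NormedSpace ℝ X] [DecidableEq L]
    {P : Finset X} {l : X → L} {R S : Set X} (h : State P l R S) :
    R ⊆ P ∧ S ⊆ P := by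
  induction h with
  | init S hS => exact ⟨Set.empty_subset _, hS.subset⟩
  | step R S S' _ _ hrep ih => exact ⟨Set.union_subset ih.1 ih.2, hrep.subset⟩

theorem State.disjoint {X L : Type*} [NormedAddCommGroup X] [NormedSpace ℝ X] [DecidableEq L]
    {P : Finset X} {l : X → L} {R S : Set X} (h : State P l R S) : Disjoint R S := by
  cases h with
  | init S hS => exact Set.empty_disjoint _
  | step R S S' _ _ hrep => exact hrep.disjoint

/-- Every execution of FCNN can be continued until it returns. -/
theorem State.exists_isOutput {X L : Type*} [NormedAddCommGroup X] [NormedSpace ℝ X]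
    [DecidableEq L] {P : Finset X} {l : X → L} {R S : Set X} (h : State P l R S) :
    ∃ R', IsOutput P l R' := by
  induction hm : P.card - R.ncard using Nat.strong_induction_on generalizing R S with
  | _ m ih =>
    rcases S.eq_empty_or_nonempty with rfl | hS
    · exact ⟨R, h⟩
    · have hsub : R ∪ S ⊆ P := Set.union_subset h.subset.1 h.subset.2
      have hfin : (R ∪ S).Finite := P.finite_toSet.subset hsub
      obtain ⟨S', hS'⟩ := exists_isRepSet P l hfin (hS.mono Set.subset_union_right)
      refine ih _ ?_ (State.step R S S' h hS hS') rfl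
      have hcard : (R ∪ S).ncard ≤ P.card := by
        simpa using Set.ncard_le_ncard hsub P.finite_toSet
      have hlt : R.ncard < (R ∪ S).ncard := by
        refine Set.ncard_lt_ncard ?_ hfin
        refine ⟨Set.subset_union_left, fun hle => ?_⟩
        obtain ⟨s, hs⟩ := hS
        exact Set.disjoint_right.1 h.disjoint hs (hle (Or.inr hs))
      omega

theorem exists_isOutput {X L : Type*} [NormedAddCommGroup X] [NormedSpace ℝ X]
    [DecidableEq L] (P : Finset X) (l : X → L) : ∃ R, IsOutput P l R := by
  obtain ⟨S, hS⟩ := exists_isCentroidSet P l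
  exact (State.init S hS).exists_isOutput

/-- Distances to the mean of a finite set are compared by comparing sums of squared distances. -/
theorem dist_mean_lt_dist_mean {E : Type*} [NormedAddCommGroup E] [InnerProductSpace ℝ E]
    (s : Finset E) {p q : E} (h : ∑ y ∈ s, dist y p ^ 2 < ∑ y ∈ s, dist y q ^ 2) :
    dist ((s.card : ℝ)⁻¹ • ∑ y ∈ s, y) p < dist ((s.card : ℝ)⁻¹ • ∑ y ∈ s, y) q := by
  have hs : s.Nonempty := by
    by_contra hs
    simp [Finset.not_nonempty_iff_eq_empty.1 hs] at h
  have hN : (0 : ℝ) < s.card := by exact_mod_cast hs.card_pos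
  set m := (s.card : ℝ)⁻¹ • ∑ y ∈ s, y with hm
  have hsum : ∑ y ∈ s, y = (s.card : ℝ) • m := by rw [hm, smul_inv_smul₀ hN.ne']
  -- Parallel axis identity: the sum depends on `p` only through its distance to the mean.
  have expand : ∀ p : E, ∑ y ∈ s, dist y p ^ 2
      = ∑ y ∈ s, ‖y‖ ^ 2 - s.card * ‖m‖ ^ 2 + s.card * dist m p ^ 2 := by
    intro p
    have : ∀ y : E, dist y p ^ 2 = ‖y‖ ^ 2 - 2 * inner ℝ y p + ‖p‖ ^ 2 := fun y => by
      rw [dist_eq_norm, norm_sub_sq_real]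
    simp only [this, Finset.sum_add_distrib, Finset.sum_sub_distrib, ← Finset.mul_sum,
      ← sum_inner, hsum, real_inner_smul_left, Finset.sum_const, nsmul_eq_mul]
    ring
  rw [expand, expand] at h
  have : dist m p ^ 2 < dist m q ^ 2 := by nlinarith
  exact lt_of_pow_lt_pow_left₀ 2 dist_nonneg this

/-! ### FCNN on an abstract ladder. -/

/-- The label of a colour. -/
def colour (σ : Bool) : Fin 2 := if σ then 1 else 0

theorem colour_injective : Function.Injective colour := by decide

/-- The points of one colour of a ladder: `n` rungs `u σ i`, an inner point and an outer point. -/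
def OnSide {E : Type*} (n : ℕ) (u : Bool → ℕ → E) (z x : Bool → E) (σ : Bool) (p : E) : Prop :=
  (∃ i < n, p = u σ i) ∨ p = z σ ∨ p = x σ

theorem rung_onSide {E : Type*} {n : ℕ} {u : Bool → ℕ → E} {z x : Bool → E} {σ : Bool} {i : ℕ}
    (hi : i < n) : OnSide n u z x σ (u σ i) :=
  Or.inl ⟨i, hi, rfl⟩

/-- The training set formed by the two sides of a ladder. -/
noncomputable def ladderSet {E : Type*} (n : ℕ) (u : Bool → ℕ → E) (z x : Bool → E) : Finset E :=
  Set.Finite.toFinset (s := {p | ∃ σ, OnSide n u z x σ p}) <| by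
    have h : {p | ∃ σ, OnSide n u z x σ p} ⊆
        (⋃ σ, u σ '' Set.Iio n) ∪ (Set.range z ∪ Set.range x) := by
      rintro p ⟨σ, ⟨i, hi, rfl⟩ | rfl | rfl⟩
      · exact Or.inl (Set.mem_iUnion.2 ⟨σ, i, hi, rfl⟩)
      · exact Or.inr (Or.inl ⟨σ, rfl⟩)
      · exact Or.inr (Or.inr ⟨σ, rfl⟩)
    refine Set.Finite.subset ?_ h
    exact (Set.finite_iUnion fun σ => (Set.finite_Iio n).image _).union
      ((Set.finite_range z).union (Set.finite_range x))

theorem mem_ladderSet {E : Type*} {n : ℕ} {u : Bool → ℕ → E} {z x : Bool → E} {p : E} :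
    p ∈ ladderSet n u z x ↔ ∃ σ, OnSide n u z x σ p := by
  simp [ladderSet]

/-- The metric conditions under which FCNN climbs down a ladder one rung per round, while
the two inner points `z σ` are the only nearest enemies. -/
structure IsLadder {E : Type*} [NormedAddCommGroup E] [NormedSpace ℝ E] (n : ℕ) (l : E → Fin 2)
    (u : Bool → ℕ → E) (z x : Bool → E) : Prop where
  label : ∀ σ p, OnSide n u z x σ p → l p = colour σ
  rung_injective : ∀ σ i j, i < n → j < n → u σ i = u σ j → i = j
  last_closer : ∀ σ τ υ i j k, i < k → k < j → j < n →
    dist (u τ j) (u υ k) < dist (u τ j) (u σ i)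
  next_misclassified : ∀ σ k, k + 1 < n →
    dist (u (!σ) (k + 1)) (u σ k) < dist (u (!σ) (k + 1)) (u (!σ) k)
  next_closest : ∀ σ j k, k + 1 < j → j < n →
    dist (u σ k) (u (!σ) (k + 1)) < dist (u σ k) (u (!σ) j)
  inner_protected : ∀ σ i k, i ≤ k → k < n → dist (z σ) (u σ k) < dist (z σ) (u (!σ) i)
  outer_protected : ∀ σ i, i < n → dist (x σ) (u σ 0) < dist (x σ) (u (!σ) i)
  inner_nearestEnemy : ∀ σ p q, OnSide n u z x σ p → OnSide n u z x (!σ) q → q ≠ z (!σ) →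
    dist p (z (!σ)) < dist p q
  mean_closer : ∀ σ p, OnSide n u z x σ p → p ≠ u σ 0 →
    dist (classMean (ladderSet n u z x) l (colour σ)) (u σ 0) <
      dist (classMean (ladderSet n u z x) l (colour σ)) p

/-- The rungs with index below `k`. -/
def rungsBelow {E : Type*} (u : Bool → ℕ → E) (k : ℕ) : Set E := {p | ∃ σ, ∃ i < k, p = u σ i}

theorem rungsBelow_succ {E : Type*} (u : Bool → ℕ → E) (k : ℕ) :
    rungsBelow u (k + 1) = rungsBelow u k ∪ Set.range (u · k) := by
  ext p
  constructor
  · rintro ⟨σ, i, hi, rfl⟩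
    rcases Nat.lt_succ_iff_lt_or_eq.1 hi with h | rfl
    · exact Or.inl ⟨σ, i, h, rfl⟩
    · exact Or.inr ⟨σ, rfl⟩
  · rintro (⟨σ, i, hi, rfl⟩ | ⟨σ, rfl⟩)
    · exact ⟨σ, i, hi.trans (Nat.lt_succ_self k), rfl⟩
    · exact ⟨σ, k, Nat.lt_succ_self k, rfl⟩

namespace IsLadder

variable {E : Type*} [NormedAddCommGroup E] [NormedSpace ℝ E] {n : ℕ} {l : E → Fin 2}
  {u : Bool → ℕ → E} {z x : Bool → E}

theorem eq_not_of_label_ne (h : IsLadder n l u z x) {σ τ : Bool} {p q : E}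
    (hp : OnSide n u z x σ p) (hq : OnSide n u z x τ q) (hne : l q ≠ l p) : τ = !σ := by
  rw [h.label σ p hp, h.label τ q hq] at hne
  revert hne
  cases σ <;> cases τ <;> simp

theorem label_rung_ne (h : IsLadder n l u z x) {σ : Bool} {i j : ℕ} (hi : i < n) (hj : j < n) :
    l (u (!σ) j) ≠ l (u σ i) := by
  rw [h.label _ _ (rung_onSide hi), h.label _ _ (rung_onSide hj)]
  exact fun hc => by simpa using colour_injective hc

/-- `inner_nearestEnemy` is strict, so ties cannot add further nearest enemies. -/
theorem kappa_le (h : IsLadder n l u z x) : kappa (ladderSet n u z x) l ≤ 2 := by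
  have hsub : {e | ∃ p ∈ ladderSet n u z x, IsNearestEnemy (ladderSet n u z x) l p e} ⊆
      {z true, z false} := by
    rintro e ⟨p, hp, he⟩
    obtain ⟨σ, hσ⟩ := mem_ladderSet.1 hp
    have hz : OnSide n u z x (!σ) (z (!σ)) := Or.inr (Or.inl rfl)
    have : e = z (!σ) := by
      refine he.eq_of_forall_lt ⟨mem_ladderSet.2 ⟨_, hz⟩, ?_⟩ ?_
      · rw [h.label _ _ hz, h.label _ _ hσ]
        exact fun hc => by simpa using colour_injective hc
      · rintro t ⟨ht, hl⟩ hne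
        obtain ⟨τ, hτ⟩ := mem_ladderSet.1 ht
        obtain rfl := h.eq_not_of_label_ne hσ hτ hl
        exact h.inner_nearestEnemy σ p t hσ hτ hne
    subst this
    cases σ <;> simp
  refine (Set.ncard_le_ncard hsub (by simp)).trans ((Set.ncard_insert_le _ _).trans ?_)
  simp

theorem centroidSet_eq (h : IsLadder n l u z x) (hn : 0 < n) {S : Set E}
    (hS : IsCentroidSet (ladderSet n u z x) l S) : S = Set.range (u · 0) := by
  obtain ⟨cen, hcen, rfl⟩ := hS
  have key : ∀ σ p, OnSide n u z x σ p → cen (l p) = u σ 0 := by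
    intro σ p hp
    have hP := mem_ladderSet.2 ⟨σ, hp⟩
    refine (hcen p hP).eq_of_forall_lt ⟨mem_ladderSet.2 ⟨σ, rung_onSide hn⟩, ?_⟩ ?_
    · rw [h.label _ _ (rung_onSide hn), h.label _ _ hp]
    · rintro t ⟨ht, hl⟩ hne
      obtain ⟨τ, hτ⟩ := mem_ladderSet.1 ht
      rw [h.label _ _ hτ, h.label _ _ hp] at hl
      obtain rfl := colour_injective hl
      rw [h.label _ _ hp]
      exact h.mean_closer _ t hτ hne
  ext s
  constructor
  · rintro ⟨p, hp, rfl⟩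
    obtain ⟨σ, hσ⟩ := mem_ladderSet.1 hp
    exact ⟨σ, (key σ p hσ).symm⟩
  · rintro ⟨σ, rfl⟩
    exact ⟨u σ 0, mem_ladderSet.2 ⟨σ, rung_onSide hn⟩, key σ _ (rung_onSide hn)⟩

/-- Only the lowest selected rungs own misclassified points, and these are lower rungs. -/
theorem eq_rung_of_mem_voren (h : IsLadder n l u z x) {k : ℕ} (hk : k < n) {nn : E → E}
    (hnn : ∀ q ∈ ladderSet n u z x, IsNearest (rungsBelow u (k + 1)) q (nn q)) {σ : Bool} {i : ℕ}
    (hi : i ≤ k) {q : E} (hq : q ∈ voren (ladderSet n u z x) l nn (u σ i)) :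
    i = k ∧ ∃ j, k < j ∧ j < n ∧ q = u (!σ) j := by
  obtain ⟨hP, hnq, hl⟩ := hq
  have hin : i < n := hi.trans_lt hk
  obtain ⟨τ, hτ⟩ := mem_ladderSet.1 hP
  obtain rfl := h.eq_not_of_label_ne (rung_onSide hin) hτ hl
  have hnear := hnn q hP
  rw [hnq] at hnear
  rcases hτ with ⟨j, hj, rfl⟩ | rfl | rfl
  · have hkj : k < j := by
      by_contra hjk
      have := hnear.eq_self ⟨!σ, j, by omega, rfl⟩
      exact hl (by rw [← this])
    refine ⟨?_, j, hkj, hj, rfl⟩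
    -- A level below `k` would lose to a rung of level `k`; the colour of the latter is immaterial.
    by_contra hik
    exact absurd (hnear.2 (u σ k) ⟨σ, k, by omega, rfl⟩)
      (not_le.2 (h.last_closer σ (!σ) σ i j k (by omega) hkj hj))
  · refine absurd (hnear.2 (u (!σ) k) ⟨!σ, k, by omega, rfl⟩) (not_le.2 ?_)
    simpa using h.inner_protected (!σ) i k hi hk
  · refine absurd (hnear.2 (u (!σ) 0) ⟨!σ, 0, by omega, rfl⟩) (not_le.2 ?_)
    simpa using h.outer_protected (!σ) i hin

/-- Earlier levels are too far away by `last_closer`, and of the two rungs at level `k` the one of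
the wrong colour is nearer. All inequalities are strict, so the choice of `nn` does not matter. -/
theorem next_mem_voren (h : IsLadder n l u z x) {k : ℕ} (hk : k + 1 < n) {nn : E → E}
    (hnn : ∀ q ∈ ladderSet n u z x, IsNearest (rungsBelow u (k + 1)) q (nn q)) (σ : Bool) :
    u (!σ) (k + 1) ∈ voren (ladderSet n u z x) l nn (u σ k) := by
  have hP : u (!σ) (k + 1) ∈ ladderSet n u z x := mem_ladderSet.2 ⟨_, rung_onSide hk⟩
  refine ⟨hP, ?_, h.label_rung_ne (by omega) hk⟩
  refine (hnn _ hP).eq_of_forall_lt ⟨σ, k, by omega, rfl⟩ ?_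
  rintro t ⟨τ, i, hi, rfl⟩ hne
  rcases (Nat.lt_succ_iff_lt_or_eq.1 hi) with hik | rfl
  · exact h.last_closer τ (!σ) σ i (k + 1) k hik (by omega) hk
  · have : τ = !σ := by
      cases σ <;> cases τ <;> simp_all
    subst this
    exact h.next_misclassified σ i hk

theorem repSet_eq (h : IsLadder n l u z x) {k : ℕ} (hk : k + 1 < n) {S : Set E}
    (hS : IsRepSet (ladderSet n u z x) l (rungsBelow u (k + 1)) S) :
    S = Set.range (u · (k + 1)) := by
  obtain ⟨nn, hnn, rep, hrep, rfl⟩ := hS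
  have key : ∀ σ, rep (u σ k) = u (!σ) (k + 1) := by
    intro σ
    have hmem := h.next_mem_voren hk hnn σ
    refine (hrep (u σ k) ⟨σ, k, by omega, rfl⟩ ⟨_, hmem⟩).eq_of_forall_lt hmem ?_
    intro t ht hne
    obtain ⟨-, j, hkj, hj, rfl⟩ := h.eq_rung_of_mem_voren (by omega) hnn le_rfl ht
    refine h.next_closest σ j k (lt_of_le_of_ne hkj ?_) hj
    rintro rfl
    exact hne rfl
  ext s
  constructor
  · rintro ⟨p, ⟨σ, i, hi, rfl⟩, ⟨q, hq⟩, rfl⟩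
    obtain ⟨rfl, -⟩ := h.eq_rung_of_mem_voren (by omega) hnn (Nat.lt_succ_iff.1 hi) hq
    exact ⟨!σ, (key σ).symm⟩
  · rintro ⟨σ, rfl⟩
    refine ⟨u (!σ) k, ⟨!σ, k, by omega, rfl⟩, ⟨_, h.next_mem_voren hk hnn (!σ)⟩, ?_⟩
    simpa using key (!σ)

/-- The loop invariant. The second alternative absorbs all rounds after the last rung, whose
behaviour is irrelevant for a lower bound. -/
theorem state (h : IsLadder n l u z x) (hn : 0 < n) {R S : Set E}
    (hRS : State (ladderSet n u z x) l R S) :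
    (∃ k < n, R = rungsBelow u k ∧ S = Set.range (u · k)) ∨ rungsBelow u n ⊆ R := by
  induction hRS with
  | init S hS => exact Or.inl ⟨0, hn, by simp [rungsBelow], h.centroidSet_eq hn hS⟩
  | step R S S' _ _ hrep ih =>
    rcases ih with ⟨k, hk, rfl, rfl⟩ | hsub
    · rw [← rungsBelow_succ] at hrep ⊢
      rcases (Nat.succ_le_of_lt hk).lt_or_eq with hlt | heq
      · exact Or.inl ⟨k + 1, hlt, rfl, h.repSet_eq hlt hrep⟩
      · exact Or.inr (by rw [← heq])
    · exact Or.inr (hsub.trans Set.subset_union_left)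

theorem card_rungs (h : IsLadder n l u z x) : (rungsBelow u n).ncard = 2 * n := by
  have : rungsBelow u n = (fun t : Bool × ℕ => u t.1 t.2) ''
      (((Finset.univ : Finset Bool) ×ˢ Finset.range n : Finset (Bool × ℕ)) : Set (Bool × ℕ)) := by
    ext p
    simp only [rungsBelow, Set.mem_ofPred_eq, Set.mem_image, Finset.mem_coe, Finset.mem_product,
      Finset.mem_univ, Finset.mem_range, true_and, Prod.exists]
    constructor
    · rintro ⟨σ, i, hi, rfl⟩
      exact ⟨σ, i, hi, rfl⟩
    · rintro ⟨σ, i, hi, rfl⟩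
      exact ⟨σ, i, hi, rfl⟩
  rw [this, Set.InjOn.ncard_image, Set.ncard_coe_finset]
  · simp
  · rintro ⟨σ, i⟩ hi ⟨τ, j⟩ hj hij
    simp only [Finset.coe_product, Finset.coe_univ, Finset.coe_range, Set.mem_prod, Set.mem_univ,
      Set.mem_Iio, true_and] at hi hj hij
    have hσ : σ = τ := colour_injective <| by
      rw [← h.label σ _ (rung_onSide hi), ← h.label τ _ (rung_onSide hj), hij]
    subst hσ
    rw [h.rung_injective σ i j hi hj hij]

theorem le_ncard_output (h : IsLadder n l u z x) (hn : 0 < n) {R : Set E}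
    (hR : IsOutput (ladderSet n u z x) l R) : 2 * n ≤ R.ncard := by
  rcases h.state hn hR with ⟨k, -, -, hk⟩ | hsub
  -- While the descent is in progress `S` is nonempty, so FCNN cannot return.
  · exact absurd hk.symm (Set.range_nonempty _).ne_empty
  · rw [← h.card_rungs]
    exact Set.ncard_le_ncard hsub ((ladderSet n u z x).finite_toSet.subset (State.subset hR).1)

end IsLadder

/-! ### Coordinates and labels. -/

/-- The point of `ℝ^(m+3)` with the given first three coordinates and zeros elsewhere. -/
noncomputable def vec (m : ℕ) (a b c : ℝ) : EuclideanSpace ℝ (Fin (m + 3)) :=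
  WithLp.toLp 2 (Fin.cons a (Fin.cons b (Fin.cons c 0)))

theorem dist_vec_sq (m : ℕ) (a b c a' b' c' : ℝ) :
    dist (vec m a b c) (vec m a' b' c') ^ 2 = (a - a') ^ 2 + (b - b') ^ 2 + (c - c') ^ 2 := by
  rw [EuclideanSpace.dist_sq_eq]
  simp [vec, Fin.sum_univ_succ, Real.dist_eq, sq_abs, add_assoc]

theorem norm_vec_sq (m : ℕ) (a b c : ℝ) : ‖vec m a b c‖ ^ 2 = a ^ 2 + b ^ 2 + c ^ 2 := by
  rw [EuclideanSpace.norm_sq_eq]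
  simp [vec, Fin.sum_univ_succ, add_assoc]

theorem vec_apply_two (m : ℕ) (a b c : ℝ) : vec m a b c 2 = c := by
  rfl

/-- The label is the side of the horizontal plane. -/
noncomputable def heightLabel (m : ℕ) (p : EuclideanSpace ℝ (Fin (m + 3))) : Fin 2 :=
  colour (decide (0 < p 2))

/-! ### Scalar estimates for repulsions and scales. -/

section Numbers

/-- The signed offset of a rung. -/
def offset (h : ℝ) (i : ℕ) : ℝ := (-1) ^ i * (h * i)

/-- The height of a rung before scaling. -/
def height (h : ℝ) (i : ℕ) : ℝ := 1 + offset h i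

/-- The tilt of a rung before scaling. -/
noncomputable def tilt (h : ℝ) (i : ℕ) : ℝ := 1 / 2 + offset h i - offset h i ^ 2 / 2 + h ^ 2

/-- The squared norm of a rung before scaling. -/
noncomputable def sqSize (h : ℝ) (i : ℕ) : ℝ := 1 + tilt h i ^ 2 + height h i ^ 2

/-- The scale of a rung. The quotient of consecutive scales puts the next rung just outside of the
sphere through the origin about the opposite rung. -/
noncomputable def scale (h η : ℝ) : ℕ → ℝ
  | 0 => 1
  | i + 1 => 3 * h ^ 2 * (1 + η) / sqSize h (i + 1) * scale h η i

/-- Minus the inner product of two unscaled rungs of opposite colour. -/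
noncomputable def repulsion (h : ℝ) (i j : ℕ) : ℝ :=
  (-1) ^ i * (-1) ^ j * (tilt h i + tilt h j) + height h i * height h j

variable {h η : ℝ} {n i j : ℕ}

theorem offset_abs_le (h0 : 0 < h) (hn : h * n ≤ 1 / 100) (hi : i ≤ n) :
    -(1 / 100) ≤ offset h i ∧ offset h i ≤ 1 / 100 := by
  have h1 : h * i ≤ 1 / 100 :=
    (mul_le_mul_of_nonneg_left (by exact_mod_cast hi) h0.le).trans hn
  have h2 : 0 ≤ h * i := by positivity
  unfold offset
  rcases neg_one_pow_eq_or ℝ i with e | e <;> rw [e] <;> constructor <;> linarith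

theorem height_bounds (h0 : 0 < h) (hn : h * n ≤ 1 / 100) (hi : i ≤ n) :
    99 / 100 ≤ height h i ∧ height h i ≤ 101 / 100 := by
  have := offset_abs_le h0 hn hi
  unfold height
  constructor <;> linarith [this.1, this.2]

theorem tilt_bounds (h0 : 0 < h) (h1 : h ≤ 1 / 100) (hn : h * n ≤ 1 / 100) (hi : i ≤ n) :
    48 / 100 ≤ tilt h i ∧ tilt h i ≤ 52 / 100 := by
  obtain ⟨ha, hb⟩ := offset_abs_le h0 hn hi
  unfold tilt
  constructor <;> nlinarith

theorem sqSize_bounds (h0 : 0 < h) (h1 : h ≤ 1 / 100) (hn : h * n ≤ 1 / 100) (hi : i ≤ n) :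
    2 ≤ sqSize h i ∧ sqSize h i ≤ 3 := by
  obtain ⟨ha, hb⟩ := tilt_bounds h0 h1 hn hi
  obtain ⟨hc, hd⟩ := height_bounds h0 hn hi
  unfold sqSize
  constructor <;> nlinarith

/-- With offsets a and b, the quadratic term of `tilt` completes the square: the value is (a + b)²/2
- 2h². For opposite parity the alternating signs turn a + b into ±h(i - j), so only the difference
of the levels remains. -/
theorem repulsion_of_odd (hij : Odd (i + j)) :
    repulsion h i j = h ^ 2 * (((i : ℝ) - j) ^ 2 / 2 - 2) := by
  have e : (-1 : ℝ) ^ i * (-1) ^ j = -1 := by rw [← pow_add, hij.neg_one_pow]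
  have e1 : ((-1 : ℝ) ^ i) ^ 2 = 1 := by rw [← pow_mul, mul_comm, pow_mul]; simp
  have e2 : ((-1 : ℝ) ^ j) ^ 2 = 1 := by rw [← pow_mul, mul_comm, pow_mul]; simp
  unfold repulsion
  rw [e]
  unfold tilt height offset
  linear_combination (h ^ 2 * i ^ 2 / 2) * e1 + (h ^ 2 * j ^ 2 / 2) * e2 + h ^ 2 * i * j * e

theorem repulsion_comm : repulsion h i j = repulsion h j i := by
  unfold repulsion
  ring

theorem repulsion_succ : repulsion h i (i + 1) = -(3 / 2 * h ^ 2) := by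
  rw [repulsion_of_odd ⟨i, by ring⟩]
  push_cast
  ring

/-- For equal parity all terms are positive and of constant size. For opposite parity,
non-consecutive levels differ by at least 3, and 9/2 - 2 = 5/2. -/
theorem le_repulsion (h0 : 0 < h) (h1 : h ≤ 1 / 100) (hn : h * n ≤ 1 / 100) (hi : i ≤ n)
    (hj : j ≤ n) (h2 : j ≠ i + 1) (h3 : i ≠ j + 1) : 5 / 2 * h ^ 2 ≤ repulsion h i j := by
  rcases Nat.even_or_odd (i + j) with hp | hp
  · have e : (-1 : ℝ) ^ i * (-1) ^ j = 1 := by rw [← pow_add, hp.neg_one_pow]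
    have ha := tilt_bounds h0 h1 hn hi
    have hb := tilt_bounds h0 h1 hn hj
    have hc := height_bounds h0 hn hi
    have hd := height_bounds h0 hn hj
    unfold repulsion
    rw [e]
    nlinarith [ha.1, hb.1, mul_nonneg (by linarith [hc.1] : 0 ≤ height h i)
      (by linarith [hd.1] : 0 ≤ height h j)]
  · rw [repulsion_of_odd hp]
    have h4 : i + 3 ≤ j ∨ j + 3 ≤ i := by
      obtain ⟨r, hr⟩ := hp
      omega
    have h5 : (9 : ℝ) ≤ ((i : ℝ) - j) ^ 2 := by
      rcases h4 with h4 | h4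
      · have : (i : ℝ) + 3 ≤ j := by exact_mod_cast h4
        nlinarith
      · have : (j : ℝ) + 3 ≤ i := by exact_mod_cast h4
        nlinarith
    nlinarith [sq_nonneg h]

theorem scale_succ_mul (h0 : 0 < h) (h1 : h ≤ 1 / 100) (hn : h * n ≤ 1 / 100) (hi : i + 1 ≤ n) :
    scale h η (i + 1) * sqSize h (i + 1) = 3 * h ^ 2 * (1 + η) * scale h η i := by
  have := (sqSize_bounds h0 h1 hn hi).1
  rw [scale]
  field_simp

theorem scale_pos (h0 : 0 < h) (e0 : 0 < η) (i : ℕ) : 0 < scale h η i := by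
  induction i with
  | zero => simp [scale]
  | succ i ih =>
    have : 0 < sqSize h (i + 1) := by unfold sqSize; positivity
    rw [scale]
    positivity

theorem scale_succ_le (h0 : 0 < h) (h1 : h ≤ 1 / 100) (hn : h * n ≤ 1 / 100) (e0 : 0 < η)
    (e1 : η ≤ 1) (hi : i + 1 ≤ n) : scale h η (i + 1) ≤ scale h η i / 1000 := by
  have h2 := scale_succ_mul (η := η) h0 h1 hn hi
  have h3 := (sqSize_bounds h0 h1 hn hi).1
  have h4 := scale_pos h0 e0 i
  have h5 := scale_pos h0 e0 (i + 1)
  have h6 : 3 * h ^ 2 * (1 + η) ≤ 6 / 10000 := by nlinarith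
  nlinarith

theorem le_scale_succ (h0 : 0 < h) (h1 : h ≤ 1 / 100) (hn : h * n ≤ 1 / 100) (e0 : 0 < η)
    (hi : i + 1 ≤ n) : h ^ 2 * scale h η i ≤ scale h η (i + 1) := by
  have h2 := scale_succ_mul (η := η) h0 h1 hn hi
  have h3 := (sqSize_bounds h0 h1 hn hi).2
  have h5 := scale_pos h0 e0 (i + 1)
  have h4 : 0 ≤ h ^ 2 * scale h η i * η := by
    have := scale_pos h0 e0 i
    positivity
  nlinarith

theorem scale_lt (h0 : 0 < h) (h1 : h ≤ 1 / 100) (hn : h * n ≤ 1 / 100) (e0 : 0 < η)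
    (e1 : η ≤ 1) (hij : i < j) (hj : j ≤ n) : scale h η j ≤ scale h η i / 1000 := by
  induction j, hij using Nat.le_induction with
  | base => exact scale_succ_le h0 h1 hn e0 e1 hj
  | succ j hij ih =>
    have h2 := ih (by omega)
    have h3 := scale_succ_le h0 h1 hn e0 e1 hj
    have h4 := scale_pos h0 e0 j
    linarith

theorem scale_le_one (h0 : 0 < h) (h1 : h ≤ 1 / 100) (hn : h * n ≤ 1 / 100) (e0 : 0 < η)
    (e1 : η ≤ 1) (hj : j ≤ n) : scale h η j ≤ 1 := by
  rcases j.eq_zero_or_pos with rfl | h2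
  · simp [scale]
  · have := scale_lt h0 h1 hn e0 e1 h2 hj
    simp only [scale] at this
    linarith

/-- The lower bound does not involve η, so η can afterwards be taken below every scale although the
scales depend on it. -/
theorem pow_le_scale (h0 : 0 < h) (h1 : h ≤ 1 / 100) (hn : h * n ≤ 1 / 100) (e0 : 0 < η)
    (hj : j ≤ n) : h ^ (2 * j) ≤ scale h η j := by
  induction j with
  | zero => simp [scale]
  | succ j ih =>
    refine le_trans ?_ (le_scale_succ h0 h1 hn e0 hj)
    calc h ^ (2 * (j + 1)) = h ^ 2 * h ^ (2 * j) := by ring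
      _ ≤ _ := by gcongr; exact ih (by omega)

end Numbers

/-! ### Rungs, poles and their distances. -/

/-- The rungs: the two colours are exchanged by swapping the first two coordinates and negating
the third. -/
noncomputable def rung (m : ℕ) (h η : ℝ) : Bool → ℕ → EuclideanSpace ℝ (Fin (m + 3))
  | true, i => vec m (scale h η i * (-1) ^ i) (-(scale h η i * (-1) ^ i * tilt h i))
      (scale h η i * height h i)
  | false, i => vec m (-(scale h η i * (-1) ^ i * tilt h i)) (scale h η i * (-1) ^ i)
      (-(scale h η i * height h i))

/-- The two points at height `±r` on the third axis. -/
noncomputable def pole (m : ℕ) (r : ℝ) : Bool → EuclideanSpace ℝ (Fin (m + 3))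
  | true => vec m 0 0 r
  | false => vec m 0 0 (-r)

theorem neg_one_pow_sq (i : ℕ) : ((-1 : ℝ) ^ i) ^ 2 = 1 := by
  rw [← pow_mul, mul_comm, pow_mul]
  simp

section Distances

variable (m : ℕ) (h η : ℝ) (σ : Bool) (i j : ℕ) (r t : ℝ)

theorem norm_rung_sq : ‖rung m h η σ i‖ ^ 2 = scale h η i ^ 2 * sqSize h i := by
  have e := neg_one_pow_sq i
  unfold sqSize
  cases σ <;> simp only [rung, norm_vec_sq] <;>
    linear_combination (scale h η i ^ 2 * (1 + tilt h i ^ 2)) * e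

theorem dist_rung_rung_sq : dist (rung m h η σ i) (rung m h η σ j) ^ 2 =
    scale h η i ^ 2 * sqSize h i + scale h η j ^ 2 * sqSize h j - 2 * (scale h η i * scale h η j) *
      ((-1) ^ i * (-1) ^ j * (1 + tilt h i * tilt h j) + height h i * height h j) := by
  have e := neg_one_pow_sq i
  have e' := neg_one_pow_sq j
  unfold sqSize
  cases σ <;> simp only [rung, dist_vec_sq] <;>
    linear_combination (scale h η i ^ 2 * (1 + tilt h i ^ 2)) * e +
      (scale h η j ^ 2 * (1 + tilt h j ^ 2)) * e'

theorem dist_rung_rung_not_sq : dist (rung m h η σ i) (rung m h η (!σ) j) ^ 2 =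
    scale h η i ^ 2 * sqSize h i + scale h η j ^ 2 * sqSize h j +
      2 * (scale h η i * scale h η j) * repulsion h i j := by
  have e := neg_one_pow_sq i
  have e' := neg_one_pow_sq j
  unfold sqSize repulsion
  cases σ <;> simp only [rung, dist_vec_sq, Bool.not_true, Bool.not_false] <;>
    linear_combination (scale h η i ^ 2 * (1 + tilt h i ^ 2)) * e +
      (scale h η j ^ 2 * (1 + tilt h j ^ 2)) * e'

theorem dist_pole_rung_sq : dist (pole m r σ) (rung m h η σ i) ^ 2 =
    scale h η i ^ 2 * sqSize h i - 2 * r * (scale h η i * height h i) + r ^ 2 := by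
  rw [← norm_rung_sq m h η σ]
  cases σ <;> simp only [rung, pole, dist_vec_sq, norm_vec_sq] <;> ring

theorem dist_pole_rung_not_sq : dist (pole m r σ) (rung m h η (!σ) i) ^ 2 =
    scale h η i ^ 2 * sqSize h i + 2 * r * (scale h η i * height h i) + r ^ 2 := by
  rw [← norm_rung_sq m h η (!σ)]
  cases σ <;> simp only [rung, pole, dist_vec_sq, norm_vec_sq, Bool.not_true, Bool.not_false] <;>
    ring

theorem dist_pole_pole_sq : dist (pole m r σ) (pole m t σ) ^ 2 = (r - t) ^ 2 := by
  cases σ <;> simp only [pole, dist_vec_sq] <;> ring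

theorem dist_pole_pole_not_sq : dist (pole m r σ) (pole m t (!σ)) ^ 2 = (r + t) ^ 2 := by
  cases σ <;> simp only [pole, dist_vec_sq, Bool.not_true, Bool.not_false] <;> ring

theorem norm_pole_sq : ‖pole m r σ‖ ^ 2 = r ^ 2 := by
  cases σ <;> simp only [pole, norm_vec_sq] <;> ring

end Distances

/-! ### Choice of parameters and the metric conditions of a ladder. -/

/-- Parameters for which the rungs and the poles at `±ε` and `±X` form a ladder. -/
structure Fits (n : ℕ) (h η ε X : ℝ) : Prop where
  n_pos : 0 < n
  h_pos : 0 < h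
  h_le : h ≤ 1 / 100
  h_mul_le : h * n ≤ 1 / 100
  η_pos : 0 < η
  η_le : η ≤ 1
  le_scale : ∀ i < n, η ≤ scale h η i
  ε_pos : 0 < ε
  ε_le : 4 * ε ≤ h ^ 2 * η ^ 3
  le_X : 100 * ((n : ℝ) + 2) ≤ X

theorem exists_fits (n : ℕ) (hn : 0 < n) : ∃ h η ε X : ℝ, Fits n h η ε X := by
  have hn1 : (1 : ℝ) ≤ n := by exact_mod_cast hn
  set h : ℝ := 1 / (100 * n) with hh
  have h0 : 0 < h := by positivity
  have hm : h * n = 1 / 100 := by rw [hh]; field_simp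
  have h1 : h ≤ 1 / 100 := by nlinarith
  have e0 : 0 < h ^ (2 * n) := by positivity
  refine ⟨h, h ^ (2 * n), h ^ 2 * (h ^ (2 * n)) ^ 3 / 4, 100 * ((n : ℝ) + 2), hn, h0, h1, hm.le,
    e0, pow_le_one₀ h0.le (by linarith), ?_, by positivity, by linarith, le_rfl⟩
  intro i hi
  exact (pow_le_pow_of_le_one h0.le (by linarith) (by omega)).trans
    (pow_le_scale h0 h1 hm.le e0 hi.le)

namespace Fits

variable {n : ℕ} {h η ε X : ℝ} {i j k : ℕ}

theorem scale_pos (H : Fits n h η ε X) (i : ℕ) : 0 < scale h η i :=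
  FCNN.scale_pos H.h_pos H.η_pos i

theorem scale_le_one (H : Fits n h η ε X) (hi : i < n) : scale h η i ≤ 1 :=
  FCNN.scale_le_one H.h_pos H.h_le H.h_mul_le H.η_pos H.η_le hi.le

theorem scale_lt (H : Fits n h η ε X) (hij : i < j) (hj : j < n) :
    scale h η j ≤ scale h η i / 1000 :=
  FCNN.scale_lt H.h_pos H.h_le H.h_mul_le H.η_pos H.η_le hij hj.le

theorem sqSize_bounds (H : Fits n h η ε X) (hi : i < n) : 2 ≤ sqSize h i ∧ sqSize h i ≤ 3 :=
  FCNN.sqSize_bounds H.h_pos H.h_le H.h_mul_le hi.le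

theorem height_bounds (H : Fits n h η ε X) (hi : i < n) :
    99 / 100 ≤ height h i ∧ height h i ≤ 101 / 100 :=
  FCNN.height_bounds H.h_pos H.h_mul_le hi.le

theorem tilt_bounds (H : Fits n h η ε X) (hi : i < n) :
    48 / 100 ≤ tilt h i ∧ tilt h i ≤ 52 / 100 :=
  FCNN.tilt_bounds H.h_pos H.h_le H.h_mul_le hi.le

theorem ε_le_η (H : Fits n h η ε X) : 4 * ε ≤ η ^ 2 / 10000 := by
  have := H.ε_le
  have h1 : h ^ 2 ≤ 1 / 10000 := by nlinarith [H.h_le, H.h_pos]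
  have h2 : η ^ 3 ≤ η ^ 2 := pow_le_pow_of_le_one H.η_pos.le H.η_le (by norm_num)
  calc 4 * ε ≤ h ^ 2 * η ^ 3 := this
    _ ≤ 1 / 10000 * η ^ 2 := by gcongr; exact pow_nonneg H.η_pos.le 3
    _ = _ := by ring

theorem ε_small (H : Fits n h η ε X) : ε ≤ 1 / 40000 := by
  have := H.ε_le_η
  nlinarith [H.η_le, H.η_pos]

theorem ε_le_scale (H : Fits n h η ε X) (hi : i < n) : 10000 * ε ≤ scale h η i := by
  have := H.ε_le_η
  have := H.le_scale i hi
  nlinarith [H.η_le, H.η_pos]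

theorem X_large (H : Fits n h η ε X) : 300 ≤ X := by
  have : (1 : ℝ) ≤ n := by exact_mod_cast H.n_pos
  linarith [H.le_X]

theorem norm_rung_bounds (H : Fits n h η ε X) (m : ℕ) (σ : Bool) (hi : i < n) :
    scale h η i ≤ ‖rung m h η σ i‖ ∧ ‖rung m h η σ i‖ ≤ 2 * scale h η i := by
  have h1 := norm_rung_sq m h η σ i
  have h2 := H.sqSize_bounds hi
  have h3 := H.scale_pos i
  constructor
  · refine (sq_le_sq₀ h3.le (norm_nonneg _)).1 ?_
    nlinarith [sq_nonneg (scale h η i)]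
  · refine (sq_le_sq₀ (norm_nonneg _) (by positivity)).1 ?_
    nlinarith [sq_nonneg (scale h η i)]

/-- Only norms matter: levels `j` and `k` are negligible in size compared with level `i`. -/
theorem last_closer (H : Fits n h η ε X) (m : ℕ) (σ τ υ : Bool) (hik : i < k) (hkj : k < j)
    (hj : j < n) :
    dist (rung m h η τ j) (rung m h η υ k) < dist (rung m h η τ j) (rung m h η σ i) := by
  have hi := (H.norm_rung_bounds m σ (hik.trans (hkj.trans hj))).1
  have hk := (H.norm_rung_bounds m υ (hkj.trans hj)).2
  have hj' := (H.norm_rung_bounds m τ hj).2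
  have h1 := H.scale_lt hik (hkj.trans hj)
  have h2 := H.scale_lt hkj hj
  have h3 := H.scale_pos i
  have h4 := dist_le_norm_add_norm (rung m h η τ j) (rung m h η υ k)
  have h5 := norm_sub_norm_le (rung m h η σ i) (rung m h η τ j)
  rw [← dist_eq_norm, dist_comm] at h5
  linarith

/-- The factor (-1)^i makes consecutive rungs of one colour have a negative inner product, about
-1/4 before scaling, while for opposite colours it is 3h²/2 > 0. -/
theorem next_misclassified (H : Fits n h η ε X) (m : ℕ) (σ : Bool) (hk : k + 1 < n) :
    dist (rung m h η (!σ) (k + 1)) (rung m h η σ k) <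
      dist (rung m h η (!σ) (k + 1)) (rung m h η (!σ) k) := by
  refine lt_of_pow_lt_pow_left₀ 2 dist_nonneg ?_
  have h1 := dist_rung_rung_not_sq m h η (!σ) (k + 1) k
  rw [Bool.not_not] at h1
  rw [h1, dist_rung_rung_sq, repulsion_comm, repulsion_succ]
  have e := neg_one_pow_sq k
  have e' : (-1 : ℝ) ^ (k + 1) * (-1) ^ k = -1 := by
    rw [pow_succ]
    linear_combination -e
  rw [e']
  have ha := H.tilt_bounds hk
  have hb := H.tilt_bounds (i := k) (by omega)
  have hc := H.height_bounds hk
  have hd := H.height_bounds (i := k) (by omega)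
  have h3 : 0 < scale h η (k + 1) * scale h η k := mul_pos (H.scale_pos _) (H.scale_pos _)
  have h4 : 0 < tilt h (k + 1) * tilt h k - 2304 / 10000 + 1 / 100 := by nlinarith
  have h5 : height h (k + 1) * height h k ≤ 10201 / 10000 := by nlinarith
  nlinarith [sq_nonneg h]

/-- The next rung of the other colour is almost on the sphere about a rung through the origin. -/
theorem dist_rung_next_sq (H : Fits n h η ε X) (m : ℕ) (σ : Bool) (hk : k + 1 < n) :
    dist (rung m h η σ k) (rung m h η (!σ) (k + 1)) ^ 2 = scale h η k ^ 2 * sqSize h k +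
      3 * h ^ 2 * η * (scale h η k * scale h η (k + 1)) := by
  have h1 := scale_succ_mul (η := η) H.h_pos H.h_le H.h_mul_le hk.le
  rw [dist_rung_rung_not_sq, repulsion_succ]
  linear_combination scale h η (k + 1) * h1

/-- Beyond the squared norm of rung `k`, the next rung costs 3h²η times the product of the scales,
while rung `j` costs at least 5h² times such a product. The factor η compensates for the smaller
scale of rung `j`, which is at least η. -/
theorem next_closest (H : Fits n h η ε X) (m : ℕ) (σ : Bool) (hkj : k + 1 < j) (hj : j < n) :
    dist (rung m h η σ k) (rung m h η (!σ) (k + 1)) <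
      dist (rung m h η σ k) (rung m h η (!σ) j) := by
  refine lt_of_pow_lt_pow_left₀ 2 dist_nonneg ?_
  rw [H.dist_rung_next_sq m σ (hkj.trans hj), dist_rung_rung_not_sq]
  have h1 := le_repulsion (i := k) (j := j) H.h_pos H.h_le H.h_mul_le (by omega) hj.le (by omega)
    (by omega)
  have h2 := H.scale_pos k
  have h3 := H.scale_pos j
  have h4 := H.scale_le_one (hkj.trans hj)
  have h5 := H.le_scale j hj
  have h6 := (H.sqSize_bounds hj).1
  have h7 : η * scale h η (k + 1) ≤ scale h η j := by
    have := mul_le_mul_of_nonneg_left h4 H.η_pos.le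
    linarith
  have h8 : 0 < scale h η j ^ 2 * sqSize h j := by positivity
  have h9 : 3 * h ^ 2 * η * (scale h η k * scale h η (k + 1)) ≤
      3 * (h ^ 2 * scale h η k) * scale h η j := by
    have := mul_le_mul_of_nonneg_left h7 (by positivity : 0 ≤ 3 * (h ^ 2 * scale h η k))
    linarith
  have h10 : 2 * (scale h η k * scale h η j) * (5 / 2 * h ^ 2) ≤
      2 * (scale h η k * scale h η j) * repulsion h k j := by gcongr
  have h11 : 0 < h ^ 2 * scale h η k * scale h η j := by
    have := H.h_pos
    positivity
  linarith

/-- The inner point lies on its own side of the horizontal plane, and the rung of level `k` has at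
most the norm of the one of level `i`. -/
theorem inner_protected (H : Fits n h η ε X) (m : ℕ) (σ : Bool) (hik : i ≤ k) (hk : k < n) :
    dist (pole m ε σ) (rung m h η σ k) < dist (pole m ε σ) (rung m h η (!σ) i) := by
  refine lt_of_pow_lt_pow_left₀ 2 dist_nonneg ?_
  rw [dist_pole_rung_sq, dist_pole_rung_not_sq]
  have hi := hik.trans_lt hk
  have h1 : scale h η k ^ 2 * sqSize h k ≤ scale h η i ^ 2 * sqSize h i := by
    rcases hik.eq_or_lt with rfl | hlt
    · exact le_rfl
    · have := H.scale_lt hlt hk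
      have h2 := H.scale_pos k
      have h4 := (H.sqSize_bounds hi).1
      have h5 := (H.sqSize_bounds hk).2
      have h3 : (1000 * scale h η k) ^ 2 ≤ scale h η i ^ 2 :=
        pow_le_pow_left₀ (by positivity) (by linarith) 2
      nlinarith [sq_nonneg (scale h η k), sq_nonneg (scale h η i)]
  have h6 : ∀ {i}, i < n → 0 < ε * (scale h η i * height h i) := fun {i} hi =>
    mul_pos H.ε_pos (mul_pos (H.scale_pos i) (by linarith [(H.height_bounds hi).1]))
  linarith [h6 hi, h6 hk]

theorem outer_protected (H : Fits n h η ε X) (m : ℕ) (σ : Bool) (hi : i < n) :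
    dist (pole m X σ) (rung m h η σ 0) < dist (pole m X σ) (rung m h η (!σ) i) := by
  refine lt_of_pow_lt_pow_left₀ 2 dist_nonneg ?_
  rw [dist_pole_rung_sq, dist_pole_rung_not_sq]
  have h0 := (H.sqSize_bounds H.n_pos).2
  have h1 := (H.height_bounds H.n_pos).1
  have h2 := H.X_large
  have h3 := H.scale_pos i
  have h4 := (H.height_bounds hi).1
  have h5 : 0 ≤ scale h η i ^ 2 * sqSize h i := by
    have := (H.sqSize_bounds hi).1
    positivity
  have h6 : 0 ≤ X * (scale h η i * height h i) := by positivity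
  have h7 : scale h η 0 = 1 := rfl
  rw [h7]
  nlinarith

/-- The squared distance to the inner point exceeds the squared norm of rung `i` by at most 4ε ≤
h²η³. The next rung exceeds it by at least 3h²η³, and any other rung by at least order η², since its
own squared norm outweighs any negative repulsion. -/
theorem inner_lt_rung (H : Fits n h η ε X) (m : ℕ) (σ : Bool) (hi : i < n) (hj : j < n) :
    dist (rung m h η σ i) (pole m ε (!σ)) < dist (rung m h η σ i) (rung m h η (!σ) j) := by
  refine lt_of_pow_lt_pow_left₀ 2 dist_nonneg ?_
  have h1 := dist_pole_rung_not_sq m h η (!σ) i ε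
  rw [Bool.not_not] at h1
  rw [dist_comm, h1]
  have s0 := H.scale_pos i
  have s1 := H.scale_pos j
  have h2 : 2 * ε * (scale h η i * height h i) + ε ^ 2 ≤ 4 * ε := by
    have h3 := (H.height_bounds hi).2
    have h4 : scale h η i * height h i ≤ 1 * (101 / 100) :=
      mul_le_mul (H.scale_le_one hi) h3 (by linarith [(H.height_bounds hi).1]) zero_le_one
    nlinarith [H.ε_pos, H.ε_small]
  have h3 : h ^ 2 * η ^ 3 < η ^ 2 := by
    have := H.ε_le_η
    have h2 : η ^ 3 ≤ η ^ 2 := pow_le_pow_of_le_one H.η_pos.le H.η_le (by norm_num)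
    have h1 : h ^ 2 ≤ 1 / 10000 := by nlinarith [H.h_le, H.h_pos]
    have h0 : 0 < η ^ 2 := pow_pos H.η_pos 2
    nlinarith [pow_pos H.η_pos 3]
  have hj2 : η ^ 2 ≤ scale h η j ^ 2 := pow_le_pow_left₀ H.η_pos.le (H.le_scale j hj) 2
  have hN := (H.sqSize_bounds hj).1
  have hε := H.ε_le
  by_cases c1 : j = i + 1
  · subst c1
    rw [H.dist_rung_next_sq m σ hj]
    have h4 : η * η ≤ scale h η i * scale h η (i + 1) :=
      mul_le_mul (H.le_scale i hi) (H.le_scale _ hj) H.η_pos.le s0.le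
    have h5 : 3 * h ^ 2 * η * (η * η) ≤ 3 * h ^ 2 * η * (scale h η i * scale h η (i + 1)) := by
      have := H.η_pos
      gcongr
    have h6 : 0 < h ^ 2 * η ^ 3 := by
      have := H.η_pos
      have := H.h_pos
      positivity
    nlinarith
  · rw [dist_rung_rung_not_sq]
    by_cases c2 : i = j + 1
    · subst c2
      rw [repulsion_comm, repulsion_succ]
      have h4 := H.scale_lt (Nat.lt_succ_self j) hi
      have h5 : h ^ 2 ≤ 1 := by nlinarith [H.h_le, H.h_pos]
      have h6 : scale h η (j + 1) * scale h η j ≤ scale h η j ^ 2 / 1000 := by nlinarith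
      have h7 : scale h η (j + 1) * scale h η j * h ^ 2 ≤ scale h η j ^ 2 / 1000 :=
        (mul_le_of_le_one_right (by positivity) h5).trans h6
      nlinarith
    · have h4 := le_repulsion (i := i) (j := j) H.h_pos H.h_le H.h_mul_le hi.le hj.le c1 c2
      have h5 : 0 ≤ 2 * (scale h η i * scale h η j) * repulsion h i j := by
        have : 0 ≤ repulsion h i j := le_trans (by positivity) h4
        positivity
      nlinarith

end Fits

theorem heightLabel_rung {h η : ℝ} (m : ℕ) (σ : Bool) (i : ℕ)
    (hp : 0 < scale h η i * height h i) : heightLabel m (rung m h η σ i) = colour σ := by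
  cases σ
  · simp [heightLabel, rung, vec_apply_two, not_lt.2 hp.le]
  · simp [heightLabel, rung, vec_apply_two, hp]

theorem heightLabel_pole {r : ℝ} (m : ℕ) (σ : Bool) (hr : 0 < r) :
    heightLabel m (pole m r σ) = colour σ := by
  cases σ
  · simp [heightLabel, pole, vec_apply_two, not_lt.2 hr.le]
  · simp [heightLabel, pole, vec_apply_two, hr]

namespace Fits

variable {n : ℕ} {h η ε X : ℝ} {i j k : ℕ}

theorem label (H : Fits n h η ε X) (m : ℕ) (σ : Bool) (p : EuclideanSpace ℝ (Fin (m + 3)))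
    (hp : OnSide n (rung m h η) (pole m ε) (pole m X) σ p) : heightLabel m p = colour σ := by
  rcases hp with ⟨i, hi, rfl⟩ | rfl | rfl
  · refine heightLabel_rung m σ i (mul_pos (H.scale_pos i) ?_)
    linarith [(H.height_bounds hi).1]
  · exact heightLabel_pole m σ H.ε_pos
  · exact heightLabel_pole m σ (by linarith [H.X_large])

theorem rung_injective (H : Fits n h η ε X) (m : ℕ) (σ : Bool) (hi : i < n) (hj : j < n)
    (hij : rung m h η σ i = rung m h η σ j) : i = j := by
  have key : ∀ {i j}, i < j → j < n → rung m h η σ i ≠ rung m h η σ j := by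
    intro i j hij hj heq
    have h1 := (H.norm_rung_bounds m σ (hij.trans hj)).1
    have h2 := (H.norm_rung_bounds m σ hj).2
    rw [heq] at h1
    linarith [H.scale_lt hij hj, H.scale_pos i]
  rcases lt_trichotomy i j with hlt | heq | hlt
  · exact absurd hij (key hlt hj)
  · exact heq
  · exact absurd hij.symm (key hlt hi)

theorem inner_nearestEnemy (H : Fits n h η ε X) (m : ℕ) (σ : Bool)
    (p q : EuclideanSpace ℝ (Fin (m + 3)))
    (hp : OnSide n (rung m h η) (pole m ε) (pole m X) σ p)
    (hq : OnSide n (rung m h η) (pole m ε) (pole m X) (!σ) q) (hne : q ≠ pole m ε (!σ)) :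
    dist p (pole m ε (!σ)) < dist p q := by
  have hε := H.ε_pos
  have hε' := H.ε_small
  have hX := H.X_large
  have hpos : ∀ {i}, i < n → 99 / 100 * scale h η i ≤ scale h η i * height h i := fun {i} hi => by
    nlinarith [H.scale_pos i, (H.height_bounds hi).1]
  have hsq : ∀ {i}, i < n → 0 < scale h η i ^ 2 * sqSize h i := fun {i} hi =>
    mul_pos (pow_pos (H.scale_pos i) 2) (by linarith [(H.sqSize_bounds hi).1])
  rcases hp with ⟨i, hi, rfl⟩ | rfl | rfl <;> rcases hq with ⟨j, hj, rfl⟩ | rfl | rfl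
  · exact H.inner_lt_rung m σ hi hj
  · exact absurd rfl hne
  · refine lt_of_pow_lt_pow_left₀ 2 dist_nonneg ?_
    have h1 := dist_pole_rung_not_sq m h η (!σ) i ε
    have h2 := dist_pole_rung_not_sq m h η (!σ) i X
    rw [Bool.not_not, dist_comm] at h1 h2
    rw [h1, h2]
    have h3 : 0 < scale h η i * height h i := by linarith [hpos hi, H.scale_pos i]
    nlinarith
  · refine lt_of_pow_lt_pow_left₀ 2 dist_nonneg ?_
    rw [dist_pole_pole_not_sq, dist_pole_rung_not_sq]
    have h1 := H.ε_le_scale hj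
    have h2 := (H.sqSize_bounds hj).1
    have h3 : 0 < ε * (scale h η j * height h j) :=
      mul_pos hε (by linarith [hpos hj, H.scale_pos j])
    have h4 : (10000 * ε) ^ 2 ≤ scale h η j ^ 2 := pow_le_pow_left₀ (by linarith) h1 2
    nlinarith
  · exact absurd rfl hne
  · refine lt_of_pow_lt_pow_left₀ 2 dist_nonneg ?_
    rw [dist_pole_pole_not_sq, dist_pole_pole_not_sq]
    nlinarith
  · refine lt_of_pow_lt_pow_left₀ 2 dist_nonneg ?_
    rw [dist_pole_pole_not_sq, dist_pole_rung_not_sq]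
    -- From height `X`, both the inner point and the rung are beyond the plane, and the rung is
    -- deeper: its depth is at least 9900ε.
    have h1 := H.ε_le_scale hj
    have h3 := hpos hj
    have h4 := hsq hj
    nlinarith
  · exact absurd rfl hne
  · refine lt_of_pow_lt_pow_left₀ 2 dist_nonneg ?_
    rw [dist_pole_pole_not_sq, dist_pole_pole_not_sq]
    nlinarith

/-! ### The first rungs are the centroids. -/

theorem norm_le_two (H : Fits n h η ε X) (m : ℕ) (σ : Bool)
    (p : EuclideanSpace ℝ (Fin (m + 3)))
    (hp : OnSide n (rung m h η) (pole m ε) (pole m X) σ p) (hne : p ≠ pole m X σ) : ‖p‖ ≤ 2 := by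
  rcases hp with ⟨i, hi, rfl⟩ | rfl | rfl
  · linarith [(H.norm_rung_bounds m σ hi).2, H.scale_le_one hi]
  · have := norm_pole_sq m σ ε
    nlinarith [norm_nonneg (pole m ε σ), H.ε_pos, H.ε_small]
  · exact absurd rfl hne

/-- Seen from the outer point, the first rung is much closer than the other inner points. -/
theorem dist_outer_gap (H : Fits n h η ε X) (m : ℕ) (σ : Bool)
    (p : EuclideanSpace ℝ (Fin (m + 3)))
    (hp : OnSide n (rung m h η) (pole m ε) (pole m X) σ p) (hne : p ≠ pole m X σ)
    (hne' : p ≠ rung m h η σ 0) :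
    dist (pole m X σ) (rung m h η σ 0) ^ 2 + 16 * ((n : ℝ) + 1) < dist (pole m X σ) p ^ 2 := by
  have hX := H.X_large
  have hX' := H.le_X
  have h0 := (H.sqSize_bounds H.n_pos).2
  have h1 := (H.height_bounds H.n_pos).1
  have h7 : scale h η 0 = 1 := rfl
  rw [dist_pole_rung_sq, h7]
  rcases hp with ⟨i, hi, rfl⟩ | rfl | rfl
  · have hi0 : 0 < i := Nat.pos_of_ne_zero (by rintro rfl; exact hne' rfl)
    rw [dist_pole_rung_sq]
    have h2 := H.scale_lt hi0 hi
    rw [h7] at h2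
    have h3 := (H.height_bounds hi).2
    have h4 := H.scale_pos i
    have h5 : scale h η i * height h i ≤ 1 / 100 := by nlinarith
    have h6 : 0 ≤ scale h η i ^ 2 * sqSize h i := by
      have := (H.sqSize_bounds hi).1
      positivity
    nlinarith
  · rw [dist_pole_pole_sq]
    nlinarith [H.ε_small, H.ε_pos]
  · exact absurd rfl hne

/-- By `dist_mean_lt_dist_mean` it suffices to compare sums of squared distances over the class. The
outer point separates the first rung from the other points near the origin by more than all
remaining terms together; the outer point itself is far from everything else. -/
theorem mean_closer (H : Fits n h η ε X) (m : ℕ) (σ : Bool)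
    (p : EuclideanSpace ℝ (Fin (m + 3)))
    (hp : OnSide n (rung m h η) (pole m ε) (pole m X) σ p) (hne : p ≠ rung m h η σ 0) :
    dist (classMean (ladderSet n (rung m h η) (pole m ε) (pole m X)) (heightLabel m) (colour σ))
        (rung m h η σ 0) <
      dist (classMean (ladderSet n (rung m h η) (pole m ε) (pole m X)) (heightLabel m) (colour σ))
        p := by
  classical
  refine dist_mean_lt_dist_mean _ ?_
  set s := (ladderSet n (rung m h η) (pole m ε) (pole m X)).filter
    (fun q => heightLabel m q = colour σ) with hs
  have hmem : ∀ y, y ∈ s ↔ OnSide n (rung m h η) (pole m ε) (pole m X) σ y := by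
    intro y
    rw [hs, Finset.mem_filter, mem_ladderSet]
    constructor
    · rintro ⟨⟨τ, hτ⟩, hl⟩
      rw [H.label m τ y hτ] at hl
      rwa [← colour_injective hl]
    · exact fun hy => ⟨⟨σ, hy⟩, H.label m σ y hy⟩
  set x := pole m X σ with hx
  set u := rung m h η σ 0 with hu
  have hxs : x ∈ s := (hmem x).2 (Or.inr (Or.inr rfl))
  have hus : OnSide n (rung m h η) (pole m ε) (pole m X) σ u := rung_onSide H.n_pos
  have hX := H.X_large
  have hux : u ≠ x := by
    intro heq
    have h1 := (H.norm_rung_bounds m σ H.n_pos).2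
    have h2 := norm_pole_sq m σ X
    rw [← hu, heq, hx] at h1
    have h7 : scale h η 0 = 1 := rfl
    rw [h7] at h1
    nlinarith [norm_nonneg (pole m X σ)]
  have hu2 := H.norm_le_two m σ u hus hux
  have hin : ∀ y ∈ s.erase x, ‖y‖ ≤ 2 := fun y hy =>
    H.norm_le_two m σ y ((hmem y).1 (Finset.mem_of_mem_erase hy)) (Finset.ne_of_mem_erase hy)
  have hyu : ∀ y ∈ s.erase x, dist y u ^ 2 ≤ 16 := fun y hy => by
    have := dist_le_norm_add_norm y u
    nlinarith [hin y hy, dist_nonneg (x := y) (y := u)]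
  rw [← Finset.add_sum_erase s _ hxs, ← Finset.add_sum_erase s _ hxs]
  by_cases hpx : p = x
  · rw [hpx]
    have hxnorm : ‖x‖ = X := by
      have := norm_pole_sq m σ X
      rw [← hx] at this
      exact (sq_eq_sq₀ (norm_nonneg _) (by linarith)).1 this
    have hfar : ∀ y ∈ s.erase x, (X - 2) ^ 2 ≤ dist y x ^ 2 := fun y hy => by
      have h1 := norm_sub_norm_le x y
      rw [← dist_eq_norm, dist_comm, hxnorm] at h1
      exact pow_le_pow_left₀ (by linarith) (by linarith [hin y hy]) 2
    set z := pole m ε σ with hz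
    have huz : u ≠ z := by
      intro heq
      have h1 := (H.norm_rung_bounds m σ H.n_pos).1
      have h2 := norm_pole_sq m σ ε
      rw [← hu, heq, hz] at h1
      have h7 : scale h η 0 = 1 := rfl
      rw [h7] at h1
      nlinarith [H.ε_small, H.ε_pos]
    have hzx : z ≠ x := by
      intro heq
      have h2 := norm_pole_sq m σ ε
      rw [← hz, heq, hxnorm] at h2
      nlinarith [H.ε_small, H.ε_pos]
    have hus' : u ∈ s.erase x := Finset.mem_erase.2 ⟨hux, (hmem u).2 hus⟩
    have hzs' : z ∈ s.erase x := Finset.mem_erase.2 ⟨hzx, (hmem z).2 (Or.inr (Or.inl rfl))⟩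
    -- The term of `u` cancels the squared distance from `x` to `u` on the other side; the term of
    -- `z` makes the inequality strict, even when there is only one rung.
    have hsum : ∑ y ∈ ({u, z} : Finset _), (dist y x ^ 2 - dist y u ^ 2) ≤
        ∑ y ∈ s.erase x, (dist y x ^ 2 - dist y u ^ 2) := by
      refine Finset.sum_le_sum_of_subset_of_nonneg ?_ ?_
      · intro y hy
        rcases Finset.mem_insert.1 hy with rfl | hy
        · exact hus'
        · rwa [Finset.mem_singleton.1 hy]
      · intro y hy _
        nlinarith [hfar y hy, hyu y hy]
    rw [Finset.sum_pair huz, Finset.sum_sub_distrib] at hsum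
    have h1 := hfar z hzs'
    have h2 := hyu z hzs'
    rw [dist_self] at hsum ⊢
    rw [dist_comm x u]
    nlinarith
  · have hgap := H.dist_outer_gap m σ p hp hpx hne
    have hcard : (s.erase x).card ≤ n + 1 := by
      have hsub : s.erase x ⊆ insert (pole m ε σ) ((Finset.range n).image (rung m h η σ)) := by
        intro y hy
        rcases (hmem y).1 (Finset.mem_of_mem_erase hy) with ⟨i, hi, rfl⟩ | rfl | rfl
        · exact Finset.mem_insert_of_mem (Finset.mem_image_of_mem _ (Finset.mem_range.2 hi))
        · exact Finset.mem_insert_self _ _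
        · exact absurd rfl (Finset.ne_of_mem_erase hy)
      refine (Finset.card_le_card hsub).trans ((Finset.card_insert_le _ _).trans ?_)
      simpa using Finset.card_image_le (s := Finset.range n) (f := rung m h η σ)
    have h1 : ∑ y ∈ s.erase x, dist y u ^ 2 ≤ 16 * ((n : ℝ) + 1) := by
      have hc : ((s.erase x).card : ℝ) ≤ n + 1 := by exact_mod_cast hcard
      refine (Finset.sum_le_card_nsmul _ _ _ hyu).trans ?_
      rw [nsmul_eq_mul]
      linarith
    have h2 : 0 ≤ ∑ y ∈ s.erase x, dist y p ^ 2 := Finset.sum_nonneg fun y _ => sq_nonneg _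
    linarith

theorem isLadder (H : Fits n h η ε X) (m : ℕ) :
    IsLadder n (heightLabel m) (rung m h η) (pole m ε) (pole m X) where
  label := H.label m
  rung_injective σ _ _ := H.rung_injective m σ
  last_closer σ τ υ _ _ _ := H.last_closer m σ τ υ
  next_misclassified σ _ := H.next_misclassified m σ
  next_closest σ _ _ := H.next_closest m σ
  inner_protected σ _ _ := H.inner_protected m σ
  outer_protected σ _ := H.outer_protected m σ
  inner_nearestEnemy := H.inner_nearestEnemy m
  mean_closer := H.mean_closer m

end Fits

end FCNN

/-! ### Conclusion. -/

theorem theorem1 :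
    ∃ (K : ℕ) (c : ℝ), 2 ≤ K ∧ 0 < c ∧
      ∀ d : ℕ, 3 ≤ d → ∀ ξ : ℝ, 0 < ξ → ξ < 1 →
        ∃ (P : Finset (EuclideanSpace ℝ (Fin d))) (l : EuclideanSpace ℝ (Fin d) → Fin K),
          (∀ k : Fin K, ∃ p ∈ P, l p = k) ∧
          (∃ R : Set (EuclideanSpace ℝ (Fin d)), FCNN.IsOutput P l R) ∧
          ∀ R : Set (EuclideanSpace ℝ (Fin d)), FCNN.IsOutput P l R →
            c * ((FCNN.kappa P l : ℝ) / ξ) ≤ (R.ncard : ℝ) := by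
  refine ⟨2, 1, le_rfl, one_pos, ?_⟩
  intro d hd ξ h0 _
  obtain ⟨m, rfl⟩ := Nat.exists_eq_add_of_le' hd
  -- With κ ≤ 2 and at least 2n selected points, n > 1/ξ gives the bound with constant 1.
  obtain ⟨n, hn⟩ := exists_nat_gt (1 / ξ)
  have hn0 : 0 < n := by
    have : (0 : ℝ) < n := lt_trans (by positivity) hn
    exact_mod_cast this
  obtain ⟨h, η, ε, X, H⟩ := FCNN.exists_fits n hn0
  have hL := H.isLadder m
  refine ⟨FCNN.ladderSet n (FCNN.rung m h η) (FCNN.pole m ε) (FCNN.pole m X),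
    FCNN.heightLabel m, ?_, FCNN.exists_isOutput _ _, ?_⟩
  · intro k
    obtain ⟨σ, rfl⟩ : ∃ σ, FCNN.colour σ = k := by
      revert k
      decide
    have hu : FCNN.OnSide n (FCNN.rung m h η) (FCNN.pole m ε) (FCNN.pole m X) σ
        (FCNN.pole m ε σ) := Or.inr (Or.inl rfl)
    exact ⟨_, FCNN.mem_ladderSet.2 ⟨σ, hu⟩, H.label m σ _ hu⟩
  · intro R hR
    have h1 : ((2 * n : ℕ) : ℝ) ≤ R.ncard := by exact_mod_cast hL.le_ncard_output hn0 hR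
    have h2 : (FCNN.kappa (FCNN.ladderSet n (FCNN.rung m h η) (FCNN.pole m ε) (FCNN.pole m X))
        (FCNN.heightLabel m) : ℝ) ≤ 2 := by exact_mod_cast hL.kappa_le
    rw [one_mul]
    refine le_trans ?_ h1
    rw [div_le_iff₀ h0]
    rw [div_lt_iff₀ h0] at hn
    push_cast
    linarith
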